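/- Let $\mathbb{C}\mathrm{ReLU}(z)=\max(\operatorname{Re}z,0)+i\max(\operatorname{Im}z,0)$. A complex-valued neural network (CVNN) $\Phi:\mathbb{C}^n\to\mathbb{C}^m$ of depth $L\ge 1$ is a map $\Phi(Y^{(0)})=Y^{(L)}$ given by $Y^{(i)}=\mathbb{C}\mathrm{ReLU}(W^{(i)}Y^{(i-1)}+b^{(i)})$ for $1\le i\le L-1$ and $Y^{(L)}=W^{(L)}Y^{(L-1)}+b^{(L)}$, with complex matrices $W^{(i)}$, complex vectors $b^{(i)}$ and $\mathbb{C}\mathrm{ReLU}$ applied entrywise; its width is the largest of the dimensions of $Y^{(0)},\dots,Y^{(L)}$. There is an absolute constant $C>0$ such that the following holds for all $n,m$, all $K\ge 0$ and all $\varepsilon>0$. Let $f:[-1,1]^n+i[-1,1]^n\to\mathbb{C}^m$ be $K$-Lipschitz with respect to the Euclidean norms on $\mathbb{C}^n$ and $\mathbb{C}^m$. Then there is a CVNN $\Phi$ of width $2n+2m+1$ and of depth $$N\le C\left(\frac{144\,mK^2(n+2)^2}{\varepsilon^2}+9\right)^{2n}$$ such that $\|f(z)-\Phi(z)\|\le\varepsilon$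 (Euclidean norm) for all $z\in[-1,1]^n+i[-1,1]^n$. -/

import Mathlib

/-- The complex ReLU: the real ReLU applied separately to the real and the imaginary part. -/
def cReLU (z : ℂ) : ℂ := ⟨max z.re 0, max z.im 0⟩

/-- A complex linear layer `x ↦ W x + b` from `ℂ^p` to `ℂ^q`. -/
structure CLinear (p q : ℕ) where
  weight : Matrix (Fin q) (Fin p) ℂ
  bias : Fin q → ℂ

/-- The affine map computed by a complex linear layer. -/
def CLinear.apply {p q : ℕ} (A : CLinear p q) (x : Fin p → ℂ) : Fin q → ℂ :=
  A.weight.mulVec x + A.bias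

/-- Complex-valued fully connected networks with input dimension `n` and output dimension `m`:
finitely many hidden layers of arbitrary sizes, followed by a linear output layer.
The hidden layers are listed starting from the input. -/
inductive CVNN : ℕ → ℕ → Type
  | output {n m : ℕ} (A : CLinear n m) : CVNN n m
  | hidden {n k m : ℕ} (A : CLinear n k) (rest : CVNN k m) : CVNN n m

/-- The function computed by a network: the activation `σ` is applied to each entry of the
output of every linear layer except the last one. -/
def CVNN.eval (σ : ℂ → ℂ) : {n m : ℕ} → CVNN n m → (Fin n → ℂ) → (Fin m → ℂ)
  | _, _, .output A, x => A.apply x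
  | _, _, .hidden A rest, x => rest.eval σ (fun j => σ (A.apply x j))

/-- The depth of a network: the number of its linear layers, including the output layer. -/
def CVNN.depth : {n m : ℕ} → CVNN n m → ℕ
  | _, _, .output _ => 1
  | _, _, .hidden _ rest => rest.depth + 1

/-- The width of a network: the largest dimension among its input, its hidden layers and its
output. -/
def CVNN.width : {n m : ℕ} → CVNN n m → ℕ
  | n, m, .output _ => max n m
  | n, _, .hidden _ rest => max n rest.width

/-- The complex cube `[-1,1]^n + i[-1,1]^n` in `ℂ^n`. -/
def complexCube (n : ℕ) : Set (EuclideanSpace ℂ (Fin n)) :=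
  {z | ∀ k, (z k).re ∈ Set.Icc (-1 : ℝ) 1 ∧ (z k).im ∈ Set.Icc (-1 : ℝ) 1}

/-! A `K`-Lipschitz map has real coordinates that are `L`-Lipschitz in the sup norm of the `2n` real
variables, with `L = K√(2n)`. A nonnegative such `F` is within `2L/N` of the maximum, over the
`N^(2n)` cell midpoints `p`, of the cones `F p - L * max_i |x i - p i|` cut off at `0`; each cone
lies below `F` (`run_maxInstrs`). This maximum is evaluated sequentially: `2n` registers hold the
input, `2m` hold running maxima and one is scratch, whence the width `2n+2m+1`. Each update is one
layer (`exists_cvnn`), because cReLU fixes nonnegative reals and so carries idle registers along. A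
grid point costs `8n+3` layers per real output, and `depth_le` absorbs the total into the stated
bound. -/

open Finset

/-! ### Register machines and their simulation by networks of constant width. -/

/-- An instruction of a ReLU register machine: the register `target` is overwritten by the
positive part of an affine function of all registers. -/
structure ReLUInstr (ι : Type) where
  target : ι
  coeff : ι → ℝ
  const : ℝ

namespace ReLUInstr

variable {ι : Type} [Fintype ι] [DecidableEq ι]

/-- The effect of one instruction on the registers. -/
noncomputable def step (v : ι → ℝ) (I : ReLUInstr ι) : ι → ℝ :=
  Function.update v I.target (max (∑ s, I.coeff s * v s + I.const) 0)

/-- The effect of a list of instructions on the registers. -/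
noncomputable def run (P : List (ReLUInstr ι)) (v : ι → ℝ) : ι → ℝ := P.foldl step v

@[simp] lemma run_nil (v : ι → ℝ) : run [] v = v := rfl

@[simp] lemma run_cons (I : ReLUInstr ι) (P : List (ReLUInstr ι)) (v : ι → ℝ) :
    run (I :: P) v = run P (step v I) := rfl

lemma run_append (P Q : List (ReLUInstr ι)) (v : ι → ℝ) :
    run (P ++ Q) v = run Q (run P v) := by
  simp [run, List.foldl_append]

lemma step_nonneg {v : ι → ℝ} (hv : ∀ s, 0 ≤ v s) (I : ReLUInstr ι) (s : ι) :
    0 ≤ step v I s := by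
  unfold step
  by_cases h : s = I.target
  · subst h; simp
  · simp [h, hv s]

/-- The complex layer that performs one instruction. -/
noncomputable def layer {w : ℕ} (e : ι ≃ Fin w) (I : ReLUInstr ι) : CLinear w w where
  weight := fun k l => if e.symm k = I.target then (I.coeff (e.symm l) : ℂ)
    else if k = l then 1 else 0
  bias := fun k => if e.symm k = I.target then (I.const : ℂ) else 0

lemma _root_.cReLU_ofReal (r : ℝ) : cReLU (r : ℂ) = ((max r 0 : ℝ) : ℂ) := by
  apply Complex.ext <;> simp [cReLU]

lemma layer_apply {w : ℕ} (e : ι ≃ Fin w) (I : ReLUInstr ι) {v : ι → ℝ} (hv : ∀ s, 0 ≤ v s) :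
    (fun k => cReLU ((layer e I).apply (fun k => (v (e.symm k) : ℂ)) k)) =
      fun k => (step v I (e.symm k) : ℂ) := by
  funext k
  by_cases h : e.symm k = I.target
  · have : (layer e I).apply (fun k => (v (e.symm k) : ℂ)) k =
        ((∑ s, I.coeff s * v s + I.const : ℝ) : ℂ) := by
      simp only [CLinear.apply, layer, Matrix.mulVec, dotProduct, Pi.add_apply, h, if_true]
      push_cast
      rw [← e.symm.sum_comp]
    rw [this, cReLU_ofReal, step, h, Function.update_self]
  · have : (layer e I).apply (fun k => (v (e.symm k) : ℂ)) k = (v (e.symm k) : ℂ) := by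
      simp [CLinear.apply, layer, Matrix.mulVec, dotProduct, h]
    rw [this, cReLU_ofReal, step, Function.update_of_ne h, max_eq_left (hv _)]

lemma exists_cvnn {w m : ℕ} (e : ι ≃ Fin w) (A : CLinear w m) (P : List (ReLUInstr ι)) :
    ∃ Ψ : CVNN w m, Ψ.depth = P.length + 1 ∧ Ψ.width = max w m ∧
      ∀ v : ι → ℝ, (∀ s, 0 ≤ v s) →
        Ψ.eval cReLU (fun k => (v (e.symm k) : ℂ)) =
          A.apply (fun k => (run P v (e.symm k) : ℂ)) := by
  induction P with
  | nil => exact ⟨.output A, rfl, rfl, fun v _ => rfl⟩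
  | cons I P ih =>
    obtain ⟨Ψ, hd, hw, he⟩ := ih
    refine ⟨.hidden (layer e I) Ψ, ?_, ?_, fun v hv => ?_⟩
    · simp [CVNN.depth, hd]
    · simp [CVNN.width, hw]
    · rw [CVNN.eval, layer_apply e I hv, he _ (step_nonneg hv I), run_cons]

end ReLUInstr

open ReLUInstr

/-! ### Maxima of cones computed with one scratch register. -/

section Machine

set_option linter.unusedSectionVars false

variable {α β : Type} [Fintype α] [DecidableEq α] [Fintype β] [DecidableEq β]

/-- The instruction `u ← max (c + a * xᵢ - u) 0` for the scratch register `u`. -/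
noncomputable def reflectInstr (i : α) (a c : ℝ) : ReLUInstr (α ⊕ Option β) where
  target := .inr none
  coeff := Pi.single (.inl i) a + Pi.single (.inr none) (-1)
  const := c

/-- Performing `reflectInstr` twice replaces `u` by `max (min (c + a * xᵢ) u) 0`. -/
lemma run_reflectInstr_twice (i : α) (a c : ℝ) (v : α ⊕ Option β → ℝ) :
    run [reflectInstr i a c, reflectInstr i a c] v =
      Function.update v (.inr none) (max (min (c + a * v (.inl i)) (v (.inr none))) 0) := by
  simp only [run_cons, run_nil, step, reflectInstr, Pi.add_apply, add_mul, sum_add_distrib,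
    Pi.single_apply, ite_mul, zero_mul, sum_ite_eq', mem_univ, if_true, Function.update_idem,
    Function.update_self]
  rw [Function.update_of_ne (by simp)]
  -- With `d = c + a * xᵢ`, the identity is `d - max (d - u) 0 = min d u`.
  congr 2
  rcases le_total (a * v (.inl i) + -1 * v (.inr none) + c) 0 with h | h
  · rw [max_eq_right h, min_eq_left (by linarith)]; ring
  · rw [max_eq_left h, min_eq_right (by linarith)]; ring

/-- The instruction `u ← max c 0`. -/
noncomputable def setInstr (c : ℝ) : ReLUInstr (α ⊕ Option β) where
  target := .inr none
  coeff := 0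
  const := c

/-- The instruction `t ← max (t + a * u) 0` for the output register `t` with index `b`. -/
noncomputable def addInstr (b : β) (a : ℝ) : ReLUInstr (α ⊕ Option β) where
  target := .inr (some b)
  coeff := Pi.single (.inr (some b)) 1 + Pi.single (.inr none) a
  const := 0

lemma run_setInstr (c : ℝ) (v : α ⊕ Option β → ℝ) :
    run [setInstr c] v = Function.update v (.inr none) (max c 0) := by
  simp [step, setInstr]

/-- Uses `max (t - u) 0 + u = max t u`; since `u ≥ 0`, the second truncation is inert. -/
lemma run_addInstr_sub_add (b : β) {v : α ⊕ Option β → ℝ} (hu : 0 ≤ v (.inr none)) :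
    run [addInstr b (-1), addInstr b 1] v =
      Function.update v (.inr (some b)) (max (v (.inr (some b))) (v (.inr none))) := by
  simp only [run_cons, run_nil, step, addInstr, Pi.add_apply, add_mul, sum_add_distrib,
    Pi.single_apply, ite_mul, zero_mul, sum_ite_eq', mem_univ, if_true, Function.update_idem,
    Function.update_self]
  rw [Function.update_of_ne (by simp)]
  congr 1
  simp only [one_mul, add_zero, neg_one_mul, ← sub_eq_add_neg]
  rw [max_eq_left (add_nonneg (le_max_right _ _) hu), ← max_add_add_right, sub_add_cancel, zero_add]

/-- Lowers `u` to `c - L * |xᵢ - pᵢ|` (but not below `0`) for all indices `i` in a list. -/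
noncomputable def coneInstrs (L c : ℝ) (p : α → ℝ) (l : List α) :
    List (ReLUInstr (α ⊕ Option β)) :=
  l.flatMap fun i =>
    [reflectInstr i L (c - L * p i), reflectInstr i L (c - L * p i)] ++
    [reflectInstr i (-L) (c + L * p i), reflectInstr i (-L) (c + L * p i)]

lemma length_coneInstrs (L c : ℝ) (p : α → ℝ) (l : List α) :
    (coneInstrs (β := β) L c p l).length = 4 * l.length := by
  induction l with
  | nil => rfl
  | cons i l ih =>
    simp only [coneInstrs, List.flatMap_cons, List.length_append, List.length_cons,
      List.length_nil] at ih ⊢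
    omega

/-- Each absolute value enters as a minimum of two affine functions, `c ± L * (xᵢ - pᵢ)`. Bounds on
`U` from both sides replace a closed formula. -/
lemma run_coneInstrs {L : ℝ} (hL : 0 ≤ L) (c : ℝ) (p : α → ℝ) (l : List α) (v : α ⊕ Option β → ℝ)
    (hu : 0 ≤ v (.inr none)) :
    ∃ U : ℝ, run (coneInstrs L c p l) v = Function.update v (.inr none) U ∧ 0 ≤ U ∧
      U ≤ v (.inr none) ∧ (∀ i ∈ l, U ≤ 0 ∨ U ≤ c - L * |v (.inl i) - p i|) ∧
      ∀ M, M ≤ v (.inr none) → (∀ i ∈ l, M ≤ c - L * |v (.inl i) - p i|) → M ≤ U := by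
  induction l generalizing v with
  | nil => exact ⟨v (.inr none), by simp [coneInstrs], hu, le_rfl, by simp, fun M h _ => h⟩
  | cons i l ih =>
    set x := v (.inl i) with hx
    set w := max (min (c + L * p i + -L * x) (max (min (c - L * p i + L * x) (v (.inr none))) 0)) 0
      with hw
    obtain ⟨U, hU, h0, hle, hcone, hge⟩ := ih (Function.update v (.inr none) w)
      (by simp [hw])
    simp only [Function.update_self, ne_eq, reduceCtorEq, not_false_eq_true, Function.update_of_ne,
      Function.update_idem] at hU hle hcone hge
    have hstep : run (coneInstrs (β := β) L c p (i :: l)) v =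
        run (coneInstrs L c p l) (Function.update v (.inr none) w) := by
      rw [coneInstrs, List.flatMap_cons, run_append, run_append, run_reflectInstr_twice,
        run_reflectInstr_twice]
      simp [coneInstrs, hw, hx]
    have hwu : w ≤ v (.inr none) :=
      max_le ((min_le_right _ _).trans (max_le (min_le_right _ _) hu)) hu
    have hw0 : w ≤ 0 ∨ w ≤ c + L * p i + -L * x := by
      rcases le_total (min (c + L * p i + -L * x)
        (max (min (c - L * p i + L * x) (v (.inr none))) 0)) 0 with h | h
      · exact .inl (by rw [hw, max_eq_right h])
      · exact .inr (by rw [hw, max_eq_left h]; exact min_le_left _ _)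
    have hw1 : w ≤ 0 ∨ w ≤ c - L * p i + L * x := by
      have h : w ≤ max (c - L * p i + L * x) 0 :=
        max_le ((min_le_right _ _).trans (max_le_max (min_le_left _ _) le_rfl)) (le_max_right _ _)
      exact (le_max_iff.mp h).symm
    refine ⟨U, hstep.trans hU, h0, hle.trans hwu, fun k hk => ?_, fun M hM hMl => ?_⟩
    · rcases List.mem_cons.mp hk with rfl | hk
      · rcases hw0 with h | h
        · exact .inl (hle.trans h)
        rcases hw1 with h' | h'
        · exact .inl (hle.trans h')
        right
        rcases abs_cases (x - p k) with ⟨h2, -⟩ | ⟨h2, -⟩ <;> rw [h2] <;> linarith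
      · exact hcone k hk
    · refine hge M ?_ fun k hk => hMl k (List.mem_cons_of_mem _ hk)
      have hi := hMl i List.mem_cons_self
      have h1 : L * (x - p i) ≤ L * |x - p i| := mul_le_mul_of_nonneg_left (le_abs_self _) hL
      have h2 : L * -(x - p i) ≤ L * |x - p i| := mul_le_mul_of_nonneg_left (neg_le_abs _) hL
      exact le_max_of_le_left (le_min (by linarith)
        (le_max_of_le_left (le_min (by linarith) hM)))

/-- Raises the output register `b` to the cone of height `c`, slope `L` and apex `p`. -/
noncomputable def bumpInstrs (b : β) (L c : ℝ) (p : α → ℝ) : List (ReLUInstr (α ⊕ Option β)) :=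
  [setInstr c] ++ coneInstrs L c p univ.toList ++ [addInstr b (-1), addInstr b 1]

lemma length_bumpInstrs (b : β) (L c : ℝ) (p : α → ℝ) :
    (bumpInstrs b L c p).length = 4 * Fintype.card α + 3 := by
  simp only [bumpInstrs, List.length_append, length_coneInstrs, length_toList, card_univ,
    List.length_cons, List.length_nil]
  omega

lemma run_bumpInstrs (b : β) {L c : ℝ} (hL : 0 ≤ L) (hc : 0 ≤ c) (p : α → ℝ)
    (v : α ⊕ Option β → ℝ) :
    ∃ U : ℝ, 0 ≤ U ∧ U ≤ c ∧ (∀ i, U ≤ 0 ∨ U ≤ c - L * |v (.inl i) - p i|) ∧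
      (∀ M, M ≤ c → (∀ i, M ≤ c - L * |v (.inl i) - p i|) → M ≤ U) ∧
      (∀ i, run (bumpInstrs b L c p) v (.inl i) = v (.inl i)) ∧
      (∀ k, k ≠ b → run (bumpInstrs b L c p) v (.inr (some k)) = v (.inr (some k))) ∧
      run (bumpInstrs b L c p) v (.inr (some b)) = max (v (.inr (some b))) U := by
  obtain ⟨U, hU, h0, hle, hcone, hge⟩ := run_coneInstrs hL c p univ.toList
    (Function.update v (.inr none) c) (by simpa using hc)
  simp only [Function.update_self, ne_eq, reduceCtorEq, not_false_eq_true, Function.update_of_ne,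
    Function.update_idem, mem_toList, mem_univ, forall_const] at hU hle hcone hge
  have hrun : run (bumpInstrs b L c p) v =
      Function.update (Function.update v (.inr none) U) (.inr (some b))
        (max (v (.inr (some b))) U) := by
    rw [bumpInstrs, run_append, run_append, run_setInstr, max_eq_left hc, hU,
      run_addInstr_sub_add b (by simpa using h0)]
    simp
  refine ⟨U, h0, hle, hcone, hge, ?_, ?_, ?_⟩ <;> rw [hrun]
  · simp
  · intro k hk; simp [hk]
  · simp

/-- Raises the output register `b` to the maximum of the cones with apices `p` in a list and
heights `F p`. -/
noncomputable def maxInstrs (b : β) (L : ℝ) (F : (α → ℝ) → ℝ) (l : List (α → ℝ)) :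
    List (ReLUInstr (α ⊕ Option β)) :=
  l.flatMap fun p => bumpInstrs b L (F p) p

lemma length_maxInstrs (b : β) (L : ℝ) (F : (α → ℝ) → ℝ) (l : List (α → ℝ)) :
    (maxInstrs b L F l).length = l.length * (4 * Fintype.card α + 3) := by
  simp [maxInstrs, List.length_flatMap, length_bumpInstrs]

lemma run_maxInstrs (b : β) {L δ : ℝ} (hL : 0 < L) {F : (α → ℝ) → ℝ} {s : Set (α → ℝ)}
    (hF : ∀ x ∈ s, ∀ y ∈ s, ∀ r, 0 ≤ r → (∀ i, |x i - y i| ≤ r) → |F x - F y| ≤ L * r)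
    (hpos : ∀ x ∈ s, 0 ≤ F x) (l : List (α → ℝ)) (hl : ∀ p ∈ l, p ∈ s) (hδ : 0 ≤ δ)
    {x : α → ℝ} (hx : x ∈ s) (v : α ⊕ Option β → ℝ) (hv : ∀ i, v (.inl i) = x i)
    (hvb : v (.inr (some b)) ≤ F x) :
    (∀ i, run (maxInstrs b L F l) v (.inl i) = x i) ∧
      (∀ k, k ≠ b → run (maxInstrs b L F l) v (.inr (some k)) = v (.inr (some k))) ∧
      v (.inr (some b)) ≤ run (maxInstrs b L F l) v (.inr (some b)) ∧
      run (maxInstrs b L F l) v (.inr (some b)) ≤ F x ∧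
      ((∃ p ∈ l, ∀ i, |x i - p i| ≤ δ) →
        F x - 2 * L * δ ≤ run (maxInstrs b L F l) v (.inr (some b))) := by
  induction l generalizing v with
  | nil => exact ⟨hv, fun _ _ => rfl, le_rfl, hvb, by simp⟩
  | cons p l ih =>
    have hp := hl p List.mem_cons_self
    obtain ⟨U, h0, hle, hcone, hge, hr1, hr2, hr3⟩ := run_bumpInstrs b hL.le (hpos p hp) p v
    simp only [hv] at hcone hge hr1
    have hUF : U ≤ F x := by
      by_cases hU : U ≤ 0
      · exact hU.trans (hpos x hx)
      -- A positive cone value `U` bounds the sup distance to the apex, so `F` drops by at most `F p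
      -- - U` between `p` and `x`.
      have hr : ∀ i, |x i - p i| ≤ (F p - U) / L := fun i => by
        rw [le_div_iff₀ hL]
        have := (hcone i).resolve_left hU
        linarith
      have := hF x hx p hp _ (div_nonneg (by linarith) hL.le) hr
      rw [mul_div_cancel₀ _ hL.ne', abs_le] at this
      linarith
    obtain ⟨h1, h2, h3, h4, h5⟩ := ih (fun q hq => hl q (List.mem_cons_of_mem _ hq))
      (run (bumpInstrs b L (F p) p) v) hr1 (by rw [hr3]; exact max_le hvb hUF)
    have hrun : run (maxInstrs b L F (p :: l)) v =
        run (maxInstrs b L F l) (run (bumpInstrs b L (F p) p) v) := by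
      rw [maxInstrs, List.flatMap_cons, run_append, maxInstrs]
    rw [hrun]
    rw [hr3] at h3
    refine ⟨h1, fun k hk => (h2 k hk).trans (hr2 k hk), (le_max_left _ _).trans h3, h4, ?_⟩
    rintro ⟨q, hq, hqx⟩
    rcases List.mem_cons.mp hq with rfl | hq
    -- One `L * δ` is lost from `F x` to `F q`, another descending the cone from `q` to `x`.
    · refine le_trans ?_ ((le_max_right _ _).trans h3)
      have hxq := abs_le.mp (hF x hx q hp δ hδ hqx)
      have hLδ : 0 ≤ L * δ := mul_nonneg hL.le hδ
      refine hge _ (by linarith) fun i => ?_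
      have := mul_le_mul_of_nonneg_left (hqx i) hL.le
      linarith
    · exact h5 ⟨q, hq, hqx⟩

/-- Runs `maxInstrs` for all output registers in a list. -/
noncomputable def approxInstrs (L : ℝ) (F : β → (α → ℝ) → ℝ) (l : List (α → ℝ)) (bs : List β) :
    List (ReLUInstr (α ⊕ Option β)) :=
  bs.flatMap fun b => maxInstrs b L (F b) l

lemma length_approxInstrs (L : ℝ) (F : β → (α → ℝ) → ℝ) (l : List (α → ℝ)) (bs : List β) :
    (approxInstrs L F l bs).length = bs.length * (l.length * (4 * Fintype.card α + 3)) := by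
  simp [approxInstrs, List.length_flatMap, length_maxInstrs]

lemma run_approxInstrs {L δ : ℝ} (hL : 0 < L) {F : β → (α → ℝ) → ℝ} {s : Set (α → ℝ)}
    (hF : ∀ b, ∀ x ∈ s, ∀ y ∈ s, ∀ r, 0 ≤ r → (∀ i, |x i - y i| ≤ r) → |F b x - F b y| ≤ L * r)
    (hpos : ∀ b, ∀ x ∈ s, 0 ≤ F b x) (l : List (α → ℝ)) (hl : ∀ p ∈ l, p ∈ s) (hδ : 0 ≤ δ)
    {x : α → ℝ} (hx : x ∈ s) (hxl : ∃ p ∈ l, ∀ i, |x i - p i| ≤ δ) (bs : List β)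
    (v : α ⊕ Option β → ℝ) (hv : ∀ i, v (.inl i) = x i)
    (hvb : ∀ b, v (.inr (some b)) ≤ F b x) (b : β) :
    run (approxInstrs L F l bs) v (.inr (some b)) ≤ F b x ∧
      v (.inr (some b)) ≤ run (approxInstrs L F l bs) v (.inr (some b)) ∧
      (b ∈ bs → F b x - 2 * L * δ ≤ run (approxInstrs L F l bs) v (.inr (some b))) := by
  induction bs generalizing v with
  | nil => exact ⟨hvb b, le_rfl, by simp⟩
  | cons a bs ih =>
    obtain ⟨h1, h2, h3, h4, h5⟩ := run_maxInstrs a hL (hF a) (hpos a) l hl hδ hx v hv (hvb a)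
    have hrun : run (approxInstrs L F l (a :: bs)) v =
        run (approxInstrs L F l bs) (run (maxInstrs a L (F a) l) v) := by
      rw [approxInstrs, List.flatMap_cons, run_append, approxInstrs]
    obtain ⟨k1, k2, k3⟩ := ih (run (maxInstrs a L (F a) l) v) h1 fun k => by
      by_cases hk : k = a
      · subst hk; exact h4
      · rw [h2 k hk]; exact hvb k
    rw [hrun]
    refine ⟨k1, ?_, fun hb => ?_⟩
    · by_cases hb : b = a
      · subst hb; exact h3.trans k2
      · rwa [h2 b hb] at k2
    · rcases List.mem_cons.mp hb with rfl | hb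
      · exact (h5 hxl).trans k2
      · exact k3 hb

/-! ### Grid points and the resulting approximation error. -/

/-- The midpoints of the cells of the uniform subdivision of `[0, 2]^α` into `N ^ card α` cubes. -/
noncomputable def gridPoints (α : Type) [Fintype α] [DecidableEq α] (N : ℕ) : List (α → ℝ) :=
  (univ : Finset (α → Fin N)).toList.map fun q i => (2 * (q i : ℝ) + 1) / N

lemma length_gridPoints (N : ℕ) : (gridPoints α N).length = N ^ Fintype.card α := by
  simp [gridPoints]

lemma gridPoints_subset {N : ℕ} (hN : 0 < N) {p : α → ℝ} (hp : p ∈ gridPoints α N) (i : α) :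
    p i ∈ Set.Icc (0 : ℝ) 2 := by
  obtain ⟨q, -, rfl⟩ := List.mem_map.mp hp
  have hN' : (0 : ℝ) < N := by exact_mod_cast hN
  have : ((q i : ℕ) : ℝ) + 1 ≤ N := by exact_mod_cast (q i).2
  exact ⟨by positivity, by rw [div_le_iff₀ hN']; linarith⟩

lemma exists_gridPoint_near {N : ℕ} (hN : 0 < N) {x : α → ℝ}
    (hx : ∀ i, x i ∈ Set.Icc (0 : ℝ) 2) :
    ∃ p ∈ gridPoints α N, ∀ i, |x i - p i| ≤ 1 / N := by
  have hN' : (0 : ℝ) < N := by exact_mod_cast hN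
  have key : ∀ i, ∃ q : Fin N, |x i - (2 * (q : ℝ) + 1) / N| ≤ 1 / N := fun i => by
    obtain ⟨h0, h2⟩ := hx i
    have hy : 0 ≤ x i * N / 2 := by positivity
    suffices h : ∃ q : Fin N, (q : ℝ) ≤ x i * N / 2 ∧ x i * N / 2 ≤ q + 1 by
      obtain ⟨q, h1, h2⟩ := h
      refine ⟨q, ?_⟩
      rw [← mul_div_cancel_right₀ (x i) hN'.ne', ← sub_div, abs_div, abs_of_pos hN']
      gcongr
      rw [abs_le]; constructor <;> linarith
    by_cases h : x i * N / 2 < N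
    · exact ⟨⟨⌊x i * N / 2⌋₊, (Nat.floor_lt hy).mpr h⟩, Nat.floor_le hy, (Nat.lt_floor_add_one _).le⟩
    -- The right endpoint `x i = 2` belongs to the last cell.
    · refine ⟨⟨N - 1, by omega⟩, ?_⟩
      rw [not_lt] at h
      have hle : x i * N / 2 ≤ N := by nlinarith
      simp only [Nat.cast_pred hN]
      constructor <;> linarith
  choose q hq using key
  exact ⟨_, List.mem_map.mpr ⟨q, by simp, rfl⟩, hq⟩

/-- Lipschitz functions on `[0, 2]^α` are approximated from below by a ReLU register machine that
has one register per input, one per output and one scratch register. -/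
lemma exists_run_approx {L : ℝ} (hL : 0 < L) {F : β → (α → ℝ) → ℝ}
    (hF : ∀ b, ∀ x ∈ Set.univ.pi fun _ => Set.Icc (0 : ℝ) 2,
      ∀ y ∈ Set.univ.pi fun _ => Set.Icc (0 : ℝ) 2,
      ∀ r, 0 ≤ r → (∀ i, |x i - y i| ≤ r) → |F b x - F b y| ≤ L * r)
    (hpos : ∀ b, ∀ x ∈ Set.univ.pi fun _ => Set.Icc (0 : ℝ) 2, 0 ≤ F b x)
    {N : ℕ} (hN : 0 < N) :
    ∃ P : List (ReLUInstr (α ⊕ Option β)),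
      P.length = Fintype.card β * (N ^ Fintype.card α * (4 * Fintype.card α + 3)) ∧
      ∀ x ∈ Set.univ.pi fun _ => Set.Icc (0 : ℝ) 2, ∀ b,
        |F b x - run P (Sum.elim x 0) (.inr (some b))| ≤ 2 * L / N := by
  refine ⟨approxInstrs L F (gridPoints α N) univ.toList, ?_, fun x hx b => ?_⟩
  · rw [length_approxInstrs, length_gridPoints, length_toList, card_univ]
  · obtain ⟨h1, -, h3⟩ := run_approxInstrs hL hF hpos (gridPoints α N)
      (fun p hp => Set.mem_univ_pi.mpr (gridPoints_subset hN hp)) (by positivity) hx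
      (exists_gridPoint_near hN (Set.mem_univ_pi.mp hx)) univ.toList (Sum.elim x 0)
      (fun _ => rfl) (fun b => hpos b x hx) b
    have h3 := h3 (by simp)
    rw [mul_one_div] at h3
    rw [abs_le]
    constructor
    · have : 0 ≤ 2 * L / N := by positivity
      linarith
    · linarith

end Machine

/-! ### Passage between complex vectors and nonnegative real registers. -/

/-- The point of `[-1, 1]^n + i [-1, 1]^n` with shifted real coordinates `x ∈ [0, 2]^(2n)`. -/
noncomputable def ofShiftedReal {n : ℕ} (x : Fin n ⊕ Fin n → ℝ) : EuclideanSpace ℂ (Fin n) :=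
  WithLp.toLp 2 fun k => ⟨x (.inl k) - 1, x (.inr k) - 1⟩

/-- The real and imaginary parts of the coordinates of `z`, shifted by `1`. -/
def toShiftedReal {n : ℕ} (z : EuclideanSpace ℂ (Fin n)) : Fin n ⊕ Fin n → ℝ :=
  Sum.elim (fun k => (z k).re + 1) (fun k => (z k).im + 1)

lemma ofShiftedReal_toShiftedReal {n : ℕ} (z : EuclideanSpace ℂ (Fin n)) :
    ofShiftedReal (toShiftedReal z) = z := by
  ext k
  apply Complex.ext <;> simp [ofShiftedReal, toShiftedReal]

lemma ofShiftedReal_mem {n : ℕ} {x : Fin n ⊕ Fin n → ℝ}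
    (hx : x ∈ Set.univ.pi fun _ => Set.Icc (0 : ℝ) 2) : ofShiftedReal x ∈ complexCube n := by
  intro k
  have h1 := hx (.inl k) trivial
  have h2 := hx (.inr k) trivial
  simp only [Set.mem_Icc, ofShiftedReal] at h1 h2 ⊢
  refine ⟨⟨?_, ?_⟩, ?_, ?_⟩ <;> linarith

lemma toShiftedReal_mem {n : ℕ} {z : EuclideanSpace ℂ (Fin n)} (hz : z ∈ complexCube n) :
    toShiftedReal z ∈ Set.univ.pi fun _ => Set.Icc (0 : ℝ) 2 := by
  rintro (k | k) - <;> obtain ⟨⟨h1, h2⟩, h3, h4⟩ := hz k <;>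
    simp only [toShiftedReal, Sum.elim_inl, Sum.elim_inr, Set.mem_Icc] <;>
    constructor <;> linarith

lemma EuclideanSpace.norm_le_of_abs_re_im_le {n : ℕ} {z : EuclideanSpace ℂ (Fin n)} {r : ℝ}
    (hr : 0 ≤ r) (h : ∀ k, |(z k).re| ≤ r ∧ |(z k).im| ≤ r) : ‖z‖ ≤ √(2 * n) * r := by
  rw [EuclideanSpace.norm_eq, ← Real.sqrt_sq hr, ← Real.sqrt_mul (by positivity)]
  apply Real.sqrt_le_sqrt
  calc ∑ k, ‖z k‖ ^ 2 ≤ ∑ _k : Fin n, 2 * r ^ 2 := by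
        refine sum_le_sum fun k _ => ?_
        rw [Complex.sq_norm, Complex.normSq_apply]
        have h1 := sq_le_sq' (abs_le.mp (h k).1).1 (abs_le.mp (h k).1).2
        have h2 := sq_le_sq' (abs_le.mp (h k).2).1 (abs_le.mp (h k).2).2
        linarith
    _ = 2 * n * r ^ 2 := by simp; ring

lemma EuclideanSpace.abs_re_le_norm {n : ℕ} (z : EuclideanSpace ℂ (Fin n)) (k : Fin n) :
    |(z k).re| ≤ ‖z‖ :=
  (Complex.abs_re_le_norm _).trans (PiLp.norm_apply_le z k)

lemma EuclideanSpace.abs_im_le_norm {n : ℕ} (z : EuclideanSpace ℂ (Fin n)) (k : Fin n) :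
    |(z k).im| ≤ ‖z‖ :=
  (Complex.abs_im_le_norm _).trans (PiLp.norm_apply_le z k)

lemma norm_ofShiftedReal_sub_le {n : ℕ} {x y : Fin n ⊕ Fin n → ℝ} {r : ℝ} (hr : 0 ≤ r)
    (h : ∀ i, |x i - y i| ≤ r) : ‖ofShiftedReal x - ofShiftedReal y‖ ≤ √(2 * n) * r := by
  refine EuclideanSpace.norm_le_of_abs_re_im_le hr fun k => ⟨?_, ?_⟩
  · simpa [ofShiftedReal] using h (.inl k)
  · simpa [ofShiftedReal] using h (.inr k)

lemma norm_le_of_mem_complexCube {n : ℕ} {z : EuclideanSpace ℂ (Fin n)} (hz : z ∈ complexCube n) :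
    ‖z‖ ≤ √(2 * n) := by
  simpa using EuclideanSpace.norm_le_of_abs_re_im_le zero_le_one
    fun k => ⟨abs_le.mpr (hz k).1, abs_le.mpr (hz k).2⟩

lemma zero_mem_complexCube (n : ℕ) : (0 : EuclideanSpace ℂ (Fin n)) ∈ complexCube n := by
  intro k; simp

section Coding

variable {n m w : ℕ} (e : (Fin n ⊕ Fin n) ⊕ Option (Fin m ⊕ Fin m) ≃ Fin w)

/-- The layer that writes the shifted real coordinates of the input into the registers. The
imaginary parts of its preactivations are negative on the complex cube. -/
noncomputable def encodeLayer : CLinear n w where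
  weight := fun k => Sum.elim
    (Sum.elim (fun i => Pi.single i 1) (fun i => Pi.single i (-Complex.I))) 0 (e.symm k)
  bias := fun k => Sum.elim (fun _ => 1 - 2 * Complex.I) 0 (e.symm k)

/-- Multiplication by `-i` moves the imaginary part of a coordinate into the real part. The bias `1
- 2i` makes real parts nonnegative and imaginary parts at most `-1`, so cReLU erases the latter. -/
lemma encodeLayer_apply {z : EuclideanSpace ℂ (Fin n)} (hz : z ∈ complexCube n) :
    (fun k => cReLU ((encodeLayer e).apply z.ofLp k)) =
      fun k => ((Sum.elim (toShiftedReal z) 0 : _ → ℝ) (e.symm k) : ℂ) := by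
  funext k
  have hx := toShiftedReal_mem hz
  rcases h : e.symm k with (i | i) | b
  · have hi := hx (.inl i) trivial
    have := (hz i).2.2
    simp only [toShiftedReal, Sum.elim_inl, Set.mem_Icc] at hi
    apply Complex.ext <;>
      simp [encodeLayer, CLinear.apply, Matrix.mulVec, h, cReLU, toShiftedReal] <;> linarith
  · have hi := hx (.inr i) trivial
    have := (hz i).1.1
    simp only [toShiftedReal, Sum.elim_inr, Set.mem_Icc] at hi
    apply Complex.ext <;>
      simp [encodeLayer, CLinear.apply, Matrix.mulVec, h, cReLU, toShiftedReal] <;> linarith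
  · apply Complex.ext <;>
      simp [encodeLayer, CLinear.apply, Matrix.mulVec, h, cReLU]

/-- The output layer that assembles the output registers, shifted by `B`, to complex numbers. -/
noncomputable def decodeLayer (B : ℝ) : CLinear w m where
  weight := fun j k =>
    (Pi.single (.inr (some (.inl j))) 1 + Pi.single (.inr (some (.inr j))) Complex.I : _ → ℂ)
      (e.symm k)
  bias := fun _ => ⟨-B, -B⟩

lemma decodeLayer_apply (B : ℝ) (v : (Fin n ⊕ Fin n) ⊕ Option (Fin m ⊕ Fin m) → ℝ) (j : Fin m) :
    (decodeLayer e B).apply (fun k => (v (e.symm k) : ℂ)) j =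
      ⟨v (.inr (some (.inl j))) - B, v (.inr (some (.inr j))) - B⟩ := by
  simp only [decodeLayer, CLinear.apply, Matrix.mulVec, dotProduct, Pi.add_apply]
  rw [e.symm.sum_comp fun s =>
    ((Pi.single (.inr (some (.inl j))) 1 : _ → ℂ) s +
      (Pi.single (.inr (some (.inr j))) Complex.I : _ → ℂ) s) * (v s : ℂ)]
  simp only [add_mul, sum_add_distrib, Pi.single_apply, ite_mul, zero_mul, sum_ite_eq', mem_univ,
    if_true]
  apply Complex.ext <;> simp <;> ring

end Coding

/-! ### Assembly of the network and the depth estimate. -/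

lemma exists_cvnn_const {n m w : ℕ} (hn : n ≤ w) (hm : m ≤ w) (c : EuclideanSpace ℂ (Fin m)) :
    ∃ Φ : CVNN n m, Φ.width = w ∧ Φ.depth = 2 ∧
      ∀ z, WithLp.toLp 2 (Φ.eval cReLU z) = c := by
  refine ⟨.hidden (k := w) ⟨0, 0⟩ (.output ⟨0, c.ofLp⟩), ?_, rfl, fun z => ?_⟩
  · simp [CVNN.width, hn, hm]
  · ext j; simp [CVNN.eval, CLinear.apply]

lemma exists_cvnn_approx {n m : ℕ} {K : NNReal}
    {f : EuclideanSpace ℂ (Fin n) → EuclideanSpace ℂ (Fin m)}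
    (hf : LipschitzOnWith K f (complexCube n)) (hK : 0 < K * √(2 * n)) {N : ℕ} (hN : 0 < N) :
    ∃ Φ : CVNN n m, Φ.width = 2 * n + 2 * m + 1 ∧
      Φ.depth = 2 * m * (N ^ (2 * n) * (8 * n + 3)) + 2 ∧
      ∀ z ∈ complexCube n, ‖f z - WithLp.toLp 2 (Φ.eval cReLU z.ofLp)‖ ≤
        √(2 * m) * (2 * (K * √(2 * n)) / N) := by
  set L : ℝ := K * √(2 * n)
  -- Bounds `‖f z‖` on the cube, so adding `B` makes every real coordinate nonnegative.
  set B : ℝ := ‖f 0‖ + L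
  have hLip : ∀ z ∈ complexCube n, ∀ w ∈ complexCube n, ‖f z - f w‖ ≤ K * ‖z - w‖ :=
    fun z hz w hw => hf.norm_sub_le hz hw
  have hB : ∀ z ∈ complexCube n, ‖f z‖ ≤ B := fun z hz => by
    have h1 := hLip z hz 0 (zero_mem_complexCube n)
    have h2 := mul_le_mul_of_nonneg_left (norm_le_of_mem_complexCube hz) K.2
    have h3 := norm_le_norm_add_norm_sub (f 0) (f z)
    rw [sub_zero] at h1
    rw [norm_sub_rev] at h3
    exact h3.trans (add_le_add le_rfl (h1.trans h2))
  let F : Fin m ⊕ Fin m → (Fin n ⊕ Fin n → ℝ) → ℝ :=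
    Sum.elim (fun j x => (f (ofShiftedReal x) j).re + B) (fun j x => (f (ofShiftedReal x) j).im + B)
  obtain ⟨P, hlen, hP⟩ := exists_run_approx (F := F) hK (fun b x hx y hy r hr hxy => by
      have h := (hLip _ (ofShiftedReal_mem hx) _ (ofShiftedReal_mem hy)).trans
        (mul_le_mul_of_nonneg_left (norm_ofShiftedReal_sub_le hr hxy) K.2)
      rw [← mul_assoc] at h
      change _ ≤ L * r at h
      rcases b with j | j
      · simpa [F] using (EuclideanSpace.abs_re_le_norm _ j).trans h
      · simpa [F] using (EuclideanSpace.abs_im_le_norm _ j).trans h)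
    (fun b x hx => by
      have h := hB _ (ofShiftedReal_mem hx)
      rcases b with j | j
      · have := (abs_le.mp ((EuclideanSpace.abs_re_le_norm _ j).trans h)).1
        simp only [F, Sum.elim_inl]; linarith
      · have := (abs_le.mp ((EuclideanSpace.abs_im_le_norm _ j).trans h)).1
        simp only [F, Sum.elim_inr]; linarith) hN
  let e : (Fin n ⊕ Fin n) ⊕ Option (Fin m ⊕ Fin m) ≃ Fin (2 * n + 2 * m + 1) :=
    Fintype.equivFinOfCardEq (by simp; ring)
  obtain ⟨Ψ, hd, hw, hΨ⟩ := exists_cvnn e (decodeLayer e B) P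
  refine ⟨.hidden (encodeLayer e) Ψ, ?_, ?_, fun z hz => ?_⟩
  · simp only [CVNN.width, hw]; omega
  · simp only [CVNN.depth, hd, hlen, Fintype.card_sum, Fintype.card_fin]; ring
  · have hx := toShiftedReal_mem hz
    rw [CVNN.eval, encodeLayer_apply e hz, hΨ _ (by
      rintro (i | b)
      · exact (hx i trivial).1
      · exact le_rfl)]
    refine EuclideanSpace.norm_le_of_abs_re_im_le (by positivity) fun j => ?_
    have h1 := hP _ hx (.inl j)
    have h2 := hP _ hx (.inr j)
    simp only [F, Sum.elim_inl, Sum.elim_inr, ofShiftedReal_toShiftedReal] at h1 h2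
    simp only [PiLp.sub_apply, decodeLayer_apply, Complex.sub_re, Complex.sub_im]
    rw [← sub_add, sub_add_eq_add_sub, ← sub_add, sub_add_eq_add_sub]
    exact ⟨h1, h2⟩

lemma eight_mul_add_three_le (n : ℕ) (hn : 1 ≤ n) : 8 * n + 3 ≤ 3 * 4 ^ n := by
  induction n, hn using Nat.le_induction with
  | base => norm_num
  | succ n hn ih => rw [pow_succ]; omega

/-- One factor `A ^ n` absorbs `N ^ (2 * n)` together with `8 * n + 3 ≤ 3 * 4 ^ n`; the other
absorbs `m`. -/
lemma depth_le {n m N : ℕ} {A : ℝ} (hn : 1 ≤ n) (hA : 1 ≤ A) (hm : (m : ℝ) ≤ A)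
    (hN : 4 * (N : ℝ) ^ 2 ≤ A) :
    ((2 * m * (N ^ (2 * n) * (8 * n + 3)) + 2 : ℕ) : ℝ) ≤ 8 * A ^ (2 * n) := by
  have h1 : (N : ℝ) ^ (2 * n) * (8 * n + 3) ≤ 3 * A ^ n :=
    calc (N : ℝ) ^ (2 * n) * (8 * n + 3) ≤ (N : ℝ) ^ (2 * n) * (3 * 4 ^ n) := by
          gcongr; exact_mod_cast eight_mul_add_three_le n hn
      _ = 3 * (4 * (N : ℝ) ^ 2) ^ n := by rw [mul_pow, ← pow_mul]; ring
      _ ≤ 3 * A ^ n := by gcongr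
  have h2 : (m : ℝ) ≤ A ^ n := hm.trans (le_self_pow₀ hA (by omega))
  have h3 : (1 : ℝ) ≤ A ^ (2 * n) := one_le_pow₀ hA
  have h4 : 2 * (m : ℝ) * ((N : ℝ) ^ (2 * n) * (8 * n + 3)) ≤ 2 * A ^ n * (3 * A ^ n) := by
    gcongr
  have h5 : 2 * A ^ n * (3 * A ^ n) = 6 * A ^ (2 * n) := by ring
  push_cast
  linarith

theorem lemma1 :
    ∃ C : ℝ, 0 < C ∧
      ∀ (n m : ℕ) (K : NNReal) (f : EuclideanSpace ℂ (Fin n) → EuclideanSpace ℂ (Fin m)),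
        LipschitzOnWith K f (complexCube n) →
        ∀ ε : ℝ, 0 < ε →
          ∃ Φ : CVNN n m,
            Φ.width = 2 * n + 2 * m + 1 ∧
            (Φ.depth : ℝ) ≤
              C * (144 * (m : ℝ) * (K : ℝ) ^ 2 * ((n : ℝ) + 2) ^ 2 / ε ^ 2 + 9) ^ (2 * n) ∧
            ∀ z ∈ complexCube n, ‖f z - WithLp.toLp 2 (Φ.eval cReLU z.ofLp)‖ ≤ ε := by
  refine ⟨8, by norm_num, fun n m K f hf ε hε => ?_⟩
  set A : ℝ := 144 * (m : ℝ) * (K : ℝ) ^ 2 * ((n : ℝ) + 2) ^ 2 / ε ^ 2 + 9 with hA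
  have hA1 : 1 ≤ A := by
    have : 0 ≤ 144 * (m : ℝ) * (K : ℝ) ^ 2 * ((n : ℝ) + 2) ^ 2 / ε ^ 2 := by positivity
    linarith
  -- If `K√(2n) ≤ ε`, the constant `f 0` suffices. Otherwise `n ≥ 1` and `2n(K/ε)² ≥ 1`, which
  -- bounds `m` by `2nq ≤ A` below.
  rcases le_or_gt (K * √(2 * n)) ε with hKε | hKε
  · obtain ⟨Φ, hw, hd, hΦ⟩ := exists_cvnn_const (n := n) (w := 2 * n + 2 * m + 1)
      (by omega) (by omega) (f 0)
    refine ⟨Φ, hw, ?_, fun z hz => ?_⟩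
    · have : 1 ≤ A ^ (2 * n) := one_le_pow₀ hA1
      rw [hd]; push_cast; linarith
    · have h1 := hf.norm_sub_le hz (zero_mem_complexCube n)
      rw [hΦ]
      rw [sub_zero] at h1
      exact h1.trans ((mul_le_mul_of_nonneg_left (norm_le_of_mem_complexCube hz) K.2).trans hKε)
  have hn : 1 ≤ n := by
    by_contra h
    obtain rfl : n = 0 := by omega
    simp at hKε; linarith
  have hn' : (1 : ℝ) ≤ n := by exact_mod_cast hn
  set q : ℝ := m * (K / ε) ^ 2 with hq
  have hq0 : 0 ≤ q := by positivity
  have hAq : A = 144 * q * (n + 2) ^ 2 + 9 := by rw [hA, hq, div_pow]; ring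
  have hmq : (m : ℝ) ≤ 2 * n * q := by
    have h1 : 1 ≤ 2 * n * (K / ε : ℝ) ^ 2 := by
      rw [div_pow, ← mul_div_assoc, one_le_div (by positivity)]
      have := pow_le_pow_left₀ hε.le hKε.le 2
      rw [mul_pow, Real.sq_sqrt (by positivity)] at this
      linarith
    calc (m : ℝ) = m * 1 := (mul_one _).symm
      _ ≤ m * (2 * n * (K / ε : ℝ) ^ 2) := by gcongr
      _ = 2 * n * q := by rw [hq]; ring
  -- The error bound `√(2m) * 2K√(2n) / N` equals `ε * 4√(nq) / N`, so any `N ≥ 4√(nq)` works; the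
  -- `+ 1` also keeps `N` positive.
  set N : ℕ := ⌊4 * √(n * q)⌋₊ + 1 with hN
  have hNlow : 4 * √(n * q) ≤ N := by
    rw [hN]; push_cast; exact (Nat.lt_floor_add_one _).le
  have hNup : (N : ℝ) ≤ 4 * √(n * q) + 1 := by
    rw [hN]; push_cast
    exact add_le_add (Nat.floor_le (by positivity)) le_rfl
  have hsq : √(n * q) ^ 2 = n * q := Real.sq_sqrt (by positivity)
  obtain ⟨Φ, hw, hd, hΦ⟩ := exists_cvnn_approx hf (hε.trans hKε) (N := N) (by omega)
  have hnq : 0 ≤ n * q := by positivity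
  have hn2q : 0 ≤ (n : ℝ) ^ 2 * q := by positivity
  refine ⟨Φ, hw, ?_, fun z hz => (hΦ z hz).trans ?_⟩
  · rw [hd]
    refine depth_le hn hA1 ?_ ?_
    · rw [hAq]; nlinarith
    -- From `(a + 1)² ≤ 2a² + 2`; hence `4N² ≤ 128nq + 8 ≤ A`.
    · have h1 : (N : ℝ) ^ 2 ≤ 2 * (16 * (n * q)) + 2 := by
        have := pow_le_pow_left₀ (Nat.cast_nonneg N) hNup 2
        nlinarith [sq_nonneg (4 * √(n * q) - 1)]
      rw [hAq]; nlinarith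
  · have hN0 : (0 : ℝ) < N := by rw [hN]; positivity
    rw [← mul_div_assoc, div_le_iff₀ hN0]
    have : √(2 * m) * (2 * (K * √(2 * n))) = ε * (4 * √(n * q)) := by
      have h1 : √(m * (K / ε : ℝ) ^ 2) = √m * (K / ε) := by
        rw [Real.sqrt_mul (by positivity), Real.sqrt_sq (by positivity)]
      have h2 : (√2 : ℝ) * √2 = 2 := Real.mul_self_sqrt (by norm_num)
      rw [hq, Real.sqrt_mul (Nat.cast_nonneg n), h1, Real.sqrt_mul (by positivity),
        Real.sqrt_mul (by positivity)]
      field_simp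
      linear_combination 2 * √m * K * h2
    rw [this]
    gcongr
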